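/- Let $a,N\in\mathbb R$. Write $(y)_j=y(y+1)\cdots(y+j-1)$ and put $$\theta_x=x(x+2a+1),\quad \sigma_x=-(2x+2a-1),\quad N_{x,j}=(x-j-N)_j,\quad D_{x,j}=(-1)^j(x-j+2a+N+2)_j,\quad \xi_{x,j}=\frac{N_{x,j}}{D_{x,j}} .$$ For $n\ge 0$ let $$R_n^{\alpha,\beta,M}(x)=\sum_{j=0}^n\frac{(-n)_j(-1)^j}{(\alpha+1)_j(-M)_j\,j!}\prod_{i=0}^{j-1}\bigl(x-i(\alpha+\beta+1+i)\bigr)$$ be the dual Hahn polynomial, which is defined when $(\alpha+1)_n\ne0$ and $(-M)_n\neq 0$. For a finite set $F$ of positive integers let $I(F)=\{1,2,\dots,\max F\}\setminus\{\max F-f: f\in F\}$, and $I(\emptyset)=\emptyset$. Let $F,G$ be finite (possibly empty) sets of positive integers, $U=I(F)$, $V=I(G)$, $m_1=|U|$, $m_3=|V|$, $m=2(m_1+m_3)$, and $$Y_u(x)=R_u^{-a,-a,2a+N}(x+2a)\ (u\in U),\qquad Z_v(x)=R_v^{-a,-a,-2-N}(x+2a)\ (v\in V),$$ where $a,N$ are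 such that all these dual Hahn polynomials are defined. Let $\Omega_1^{a,\mathcal F}(x)$, $\mathcal F=(F,G)$, be the determinant of size $m_1+m_3$ whose $j$-th column ($1\le j\le m_1+m_3$) has the entries $\xi_{x-2j+1,\,m-2j+1}\,Y_u(\theta_{x-2j+1})$, $u\in U$, followed by the entries $Z_v(\theta_{x-2j+1})$, $v\in V$ (each in increasing order of the index). Let $$p(x)=\prod_{j=1}^{m_1-1}D_{x-1,2j}\,N_{x-m+2j+1,2j},\qquad q(x)=\prod_{i=1}^{\lfloor (m_1+m_3)/2\rfloor}\ \prod_{j=1}^{m-4i+1}\sigma_{x-m+2i+j},$$ $$H(x)=\frac{\sigma_{x-m_1-m_3+1}\,(D_{x-1,m-1})^{m_1}}{p(x)\,q(x)\,(N_{x-m+1,1})^{m_1}} .$$ Then $H(x)\Omega_1^{a,\mathcal F}(x)$ is a polynomial; more precisely, $H(x)\Omega_1^{a,\mathcal F}(x)=\sigma_{x-m_1-m_3+1}P(x)$ with a polynomial $P$. If moreover $v-u+a+N+1\neq 0$ for all $u\in U$, $v\in V$, then $P$ is nonzero and has degree $$d=2\Bigl(\sum_{u\in U}u+\sum_{v\in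 V}v-\binom{m_1}{2}-\binom{m_3}{2}\Bigr).$$ -/

import Mathlib

open Polynomial

noncomputable section

namespace KrallHahn

/-- The Pochhammer symbol `(y)_j = y (y + 1) ⋯ (y + j - 1)` of a polynomial `y` in `x`. -/
def poch (y : ℝ[X]) (j : ℕ) : ℝ[X] := ∏ i ∈ Finset.range j, (y + (i : ℝ[X]))

/-- `θ_y = y (y + 2 a + 1)`. Subscripts such as `x - 3` are encoded as polynomials `y` in `x`,
so that `θ_{x-3}` is `theta a (X - 3)`; the same convention is used for `σ`, `N` and `D`. -/
def theta (a : ℝ) (y : ℝ[X]) : ℝ[X] := y * (y + C (2 * a + 1))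

/-- `σ_y = -(2 y + 2 a - 1)`. -/
def sigma (a : ℝ) (y : ℝ[X]) : ℝ[X] := -(2 * y + C (2 * a - 1))

/-- `N_{y,j} = (y - j - N)_j`. -/
def numN (N : ℝ) (y : ℝ[X]) (j : ℕ) : ℝ[X] := poch (y - (j : ℝ[X]) - C N) j

/-- `D_{y,j} = (-1)^j (y - j + 2 a + N + 2)_j`. -/
def denD (a N : ℝ) (y : ℝ[X]) (j : ℕ) : ℝ[X] :=
  (-1) ^ j * poch (y - (j : ℝ[X]) + C (2 * a + N + 2)) j

/-- `ξ¹_{y,j} = N_{y,j} / D_{y,j}`, a rational function. -/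
def xi1 (a N : ℝ) (y : ℝ[X]) (j : ℕ) : RatFunc ℝ :=
  algebraMap ℝ[X] (RatFunc ℝ) (numN N y j) / algebraMap ℝ[X] (RatFunc ℝ) (denD a N y j)

/-- `ξ³_{y,j} = 1`. -/
def xi3 (_y : ℝ[X]) (_j : ℕ) : RatFunc ℝ := 1

/-- The real Pochhammer symbol `(c)_j`. -/
def rpoch (c : ℝ) (j : ℕ) : ℝ := ∏ i ∈ Finset.range j, (c + (i : ℝ))

/-- The dual Hahn polynomial `R_n^{α,β,M}`, that is, the polynomial with
`R_n^{α,β,M}(t (t + α + β + 1)) = ₃F₂(-n, -t, t + α + β + 1; α + 1, -M; 1)`. Here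
`(-t)_j (t + α + β + 1)_j = (-1)^j ∏_{i<j} (t (t + α + β + 1) - i (α + β + 1 + i))`. -/
def dualHahn (α β M : ℝ) (n : ℕ) : ℝ[X] :=
  ∑ j ∈ Finset.range (n + 1),
    C (rpoch (-(n : ℝ)) j * (-1) ^ j / (rpoch (α + 1) j * rpoch (-M) j * (j.factorial : ℝ))) *
      ∏ i ∈ Finset.range j, (X - C ((i : ℝ) * (α + β + 1 + (i : ℝ))))

/-- The denominators `(α + 1)_j`, `(-M)_j`, `j ≤ n`, of `R_n^{α,β,M}` do not vanish. -/
def DualHahnDefined (α M : ℝ) (n : ℕ) : Prop := rpoch (α + 1) n ≠ 0 ∧ rpoch (-M) n ≠ 0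

/-- The involution `I(F) = {1, …, max F} \ {max F - f : f ∈ F}`, with `I(∅) = ∅`. -/
def invol (F : Finset ℕ) : Finset ℕ :=
  Finset.Icc 1 (F.sup id) \ F.image (fun f => F.sup id - f)

/-- The quasi-Casoratian determinant `Ω₁` of finite sets `U`, `V`, families `Y`, `Z` of
polynomials and coefficients `ξ¹`, `ξ³`: with `m = 2 (|U| + |V|)` and columns
`j = 1, …, |U| + |V|`, the rows are `ξ¹_{x-2j+1,m-2j+1} Y_u(θ_{x-2j+1})`, `u ∈ U`, followed by
`ξ³_{x-2j+1,m-2j+1} Z_v(θ_{x-2j+1})`, `v ∈ V`, each in increasing order of the index. -/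
def quasiCasoratian₁ (U V : Finset ℕ) (Y Z : ℕ → ℝ[X]) (ξ₁ ξ₃ : ℝ[X] → ℕ → RatFunc ℝ)
    (θ : ℝ[X] → ℝ[X]) : RatFunc ℝ :=
  Matrix.det (Matrix.of fun i k : Fin (U.card + V.card) =>
    let j : ℕ := (k : ℕ) + 1
    let m : ℕ := 2 * (U.card + V.card)
    let y : ℝ[X] := X - 2 * (j : ℝ[X]) + 1
    Fin.addCases
      (fun r : Fin U.card =>
        ξ₁ y (m - 2 * j + 1) *
          algebraMap ℝ[X] (RatFunc ℝ) ((Y (U.orderEmbOfFin rfl r)).comp (θ y)))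
      (fun r : Fin V.card =>
        ξ₃ y (m - 2 * j + 1) *
          algebraMap ℝ[X] (RatFunc ℝ) ((Z (V.orderEmbOfFin rfl r)).comp (θ y))) i)

/-- `Y_u(x) = R_u^{-a,-a,2a+N}(x + 2a)`. -/
def polyY (a N : ℝ) (u : ℕ) : ℝ[X] := (dualHahn (-a) (-a) (2 * a + N) u).comp (X + C (2 * a))

/-- `Z_u(x) = R_u^{-a,-a,-2-N}(x + 2a)`. -/
def polyZ (a N : ℝ) (u : ℕ) : ℝ[X] := (dualHahn (-a) (-a) (-2 - N) u).comp (X + C (2 * a))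

/-- The Krall-Hahn determinant `Ω₁^{a,(F,G)}`, with `U = I(F)` and `V = I(G)`. -/
def Omega₁ (a N : ℝ) (F G : Finset ℕ) : RatFunc ℝ :=
  quasiCasoratian₁ (invol F) (invol G) (polyY a N) (polyZ a N) (xi1 a N) xi3 (theta a)

/-- `p(x) = ∏_{j=1}^{m₁-1} D_{x-1,2j} N_{x-m+2j+1,2j}`, with `m = 2 (m₁ + m₃)`. -/
def polyp (a N : ℝ) (m₁ m₃ : ℕ) : ℝ[X] :=
  ∏ j ∈ Finset.Icc 1 (m₁ - 1),
    denD a N (X - 1) (2 * j) *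
      numN N (X - ((2 * (m₁ + m₃) : ℕ) : ℝ[X]) + 2 * (j : ℝ[X]) + 1) (2 * j)

/-- `q(x) = ∏_{i=1}^{⌊(m₁+m₃)/2⌋} ∏_{j=1}^{m-4i+1} σ_{x-m+2i+j}`, with `m = 2 (m₁ + m₃)`. -/
def polyq (a : ℝ) (m₁ m₃ : ℕ) : ℝ[X] :=
  ∏ i ∈ Finset.Icc 1 ((m₁ + m₃) / 2), ∏ j ∈ Finset.Icc 1 (2 * (m₁ + m₃) - 4 * i + 1),
    sigma a (X - ((2 * (m₁ + m₃) : ℕ) : ℝ[X]) + 2 * (i : ℝ[X]) + (j : ℝ[X]))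

/-- `H(x) = σ_{x-m₁-m₃+1} (D_{x-1,m-1})^{m₁} / (p(x) q(x) (N_{x-m+1,1})^{m₁})`, with
`m = 2 (m₁ + m₃)`. (If `m = 0` then `m₁ = 0` and both powers are `1`.) -/
def ratH (a N : ℝ) (m₁ m₃ : ℕ) : RatFunc ℝ :=
  algebraMap ℝ[X] (RatFunc ℝ)
      (sigma a (X - (m₁ : ℝ[X]) - (m₃ : ℝ[X]) + 1) *
        denD a N (X - 1) (2 * (m₁ + m₃) - 1) ^ m₁) /
    algebraMap ℝ[X] (RatFunc ℝ)
      (polyp a N m₁ m₃ * polyq a m₁ m₃ *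
        numN N (X - ((2 * (m₁ + m₃) : ℕ) : ℝ[X]) + 1) 1 ^ m₁)

end KrallHahn

end

/-!
The row factor `D_{x-1,m-1} / N_{x-m+1,1}`, which `H` contains once for each `u ∈ U`, turns `ξ` into
a polynomial weight: the rows of `U` become `w_c Y_u(θ_{x-2c-1})`, where `c = 0, …, n - 1` is the
column, `n = m₁ + m₃`, and
`w_c = (x - 2n - N + 1)_{2(n-1-c)} · (x + 2a + N) (x + 2a + N - 1) ⋯ (x + 2a + N - 2c + 1)`
(`denD_mul_numN`, `denD_pow_mul_quasiCasoratian₁`). So `H Ω₁ = σ det / (p q)`, where `det` is the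
determinant of this matrix of polynomials, and the claims are that `p q` divides `det` and that
`det` has a certain degree.

*Divisibility.* The two factors of the weights form chains for divisibility, and `p` is the least
product that a selection of `m₁` distinct columns can give; hence `p` divides each term of the
Leibniz formula (`pPoly_dvd_det`). The polynomial `q` is, up to a constant, the Vandermonde product
of the nodes `θ_{x-2c-1}`. At a zero of `θ_{x-2c-1} - θ_{x-2c'-1}` the weights of the columns `c`
and `c'` agree as well (`eval_weight_eq`), so that these columns are equal, and `q` divides `det`
(`pow_dvd_det`, `qPoly_dvd_det`). The roots of `p` and `q` are distinct if `N` is generic. Then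
`p q` divides `det`, and this survives specialization, as `p q` is monic up to a constant
(`pPoly_mul_qPoly_dvd_det`).

*Degree.* Replacing the columns by their iterated differences does not change `det`. Seen as a
function of `t = x - 2c`, a row of `V` behaves like `t ^ (2v)`, and a row of `U` like
`t ^ (2u - 2a - 2N - 2)` up to a factor that does not depend on `c`: the ratio of consecutive
weights is a ratio of monic quadratic polynomials. Each difference lowers the exponent `ε` by one and
multiplies the leading coefficient by `-2 ε` (`leadsAt_weightedDiff`, `leadsAt_unweightedDiff`).
The coefficients that the differences of order `l` contribute are thus falling factorials of the
exponents, and their determinant is a Vandermonde determinant in the `ε`, which is nonzero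
exactly when the exponents are distinct (`natDegree_det_polyMatrix`). Between `U` and `V` this is
the condition `v - u + a + N + 1 ≠ 0`.
-/

namespace KrallHahn

/-! ### The determinant with polynomial entries -/

section Generic

variable {S : Type*} [CommRing S]

/-- The product `(x - 2n - N + 1)_{2k}`, the part of the weight of a column that comes from the
numerator of `ξ`. -/
noncomputable def numWeight (N : S) (n k : ℕ) : S[X] :=
  ∏ r ∈ Finset.range (2 * k), (X - C (2 * (n : S) + N - 1 - (r : S)))

/-- The product `(x + 2a + N)(x + 2a + N - 1) ⋯` of `2k` factors, written with `h = a + 3/2`: the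
part of the weight of a column that comes from the denominator of `ξ`. -/
noncomputable def denWeight (h N : S) (k : ℕ) : S[X] :=
  ∏ r ∈ Finset.range (2 * k), (X - C (3 - 2 * h - N + (r : S)))

/-- The polynomial `θ_{x-2c-1}`, written with `h = a + 3/2`. The columns are numbered from `c = 0`
on. -/
noncomputable def node (h : S) (c : ℕ) : S[X] :=
  (X - C (2 * (c : S) + 1)) * (X - C (2 * (c : S) + 1) + C (2 * h - 2))

/-- The matrix of polynomials that remains of the quasi-Casoratian matrix once the rows are
cleared of denominators. Row `i` comes from the polynomial `g i`, and the rows in `A` carry the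
weights of the columns. -/
noncomputable def polyMatrix (h N : S) (n : ℕ) (A : Finset (Fin n)) (g : Fin n → S[X]) :
    Matrix (Fin n) (Fin n) S[X] :=
  Matrix.of fun i c =>
    (if i ∈ A then numWeight N n (n - 1 - c) * denWeight h N c else 1) * (g i).comp (node h c)

/-- The polynomial `p` for `m₁ = k`. -/
noncomputable def pPoly (h N : S) (n k : ℕ) : S[X] :=
  ∏ j ∈ Finset.range k, (denWeight h N j * numWeight N n j)

/-- The monic associate of the polynomial `q`; the factor with index `s` is a constant multiple of
`σ_{x-s+2}`. -/
noncomputable def qPoly (h : S) (n : ℕ) : S[X] :=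
  ∏ i ∈ Finset.Icc 1 (n / 2), ∏ s ∈ Finset.Icc (2 * i + 1) (2 * n - 2 * i + 1),
    (X - C ((s : S) - h))

theorem monic_numWeight (N : S) (n k : ℕ) : (numWeight N n k).Monic :=
  monic_prod_of_monic _ _ fun _ _ => monic_X_sub_C _

theorem monic_denWeight (h N : S) (k : ℕ) : (denWeight h N k).Monic :=
  monic_prod_of_monic _ _ fun _ _ => monic_X_sub_C _

theorem monic_pPoly (h N : S) (n k : ℕ) : (pPoly h N n k).Monic :=
  monic_prod_of_monic _ _ fun _ _ => (monic_denWeight _ _ _).mul (monic_numWeight _ _ _)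

theorem monic_qPoly (h : S) (n : ℕ) : (qPoly h n).Monic :=
  monic_prod_of_monic _ _ fun _ _ => monic_prod_of_monic _ _ fun _ _ => monic_X_sub_C _

section Map

variable {T : Type*} [CommRing T] (φ : S →+* T)

theorem map_numWeight (N : S) (n k : ℕ) : (numWeight N n k).map φ = numWeight (φ N) n k := by
  simp [numWeight, Polynomial.map_prod, map_ofNat]

theorem map_denWeight (h N : S) (k : ℕ) : (denWeight h N k).map φ = denWeight (φ h) (φ N) k := by
  simp [denWeight, Polynomial.map_prod, map_ofNat]

theorem map_node (h : S) (c : ℕ) : (node h c).map φ = node (φ h) c := by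
  simp [node, map_ofNat]

theorem map_pPoly (h N : S) (n k : ℕ) : (pPoly h N n k).map φ = pPoly (φ h) (φ N) n k := by
  simp [pPoly, Polynomial.map_prod, map_numWeight, map_denWeight]

theorem map_qPoly (h : S) (n : ℕ) : (qPoly h n).map φ = qPoly (φ h) n := by
  simp [qPoly, Polynomial.map_prod]

theorem map_det_polyMatrix (h N : S) (n : ℕ) (A : Finset (Fin n)) (g : Fin n → S[X]) :
    (polyMatrix h N n A g).det.map φ
      = (polyMatrix (φ h) (φ N) n A fun i => (g i).map φ).det := by
  rw [← coe_mapRingHom, RingHom.map_det]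
  congr 1
  ext1 i c
  by_cases hi : i ∈ A <;>
    simp [polyMatrix, hi, map_numWeight, map_denWeight, map_node, Polynomial.map_comp]

end Map

/-! ### Divisibility by `p` -/

theorem prod_range_dvd_prod {M : Type*} [CommMonoid M] {G : ℕ → M} (hG : ∀ i, G i ∣ G (i + 1))
    (s : Finset ℕ) : ∏ i ∈ Finset.range s.card, G i ∣ ∏ i ∈ s, G i := by
  have hmono : ∀ {i j : ℕ}, i ≤ j → G i ∣ G j := fun {i j} hij => by
    induction hij with
    | refl => exact dvd_rfl
    | step _ ih => exact ih.trans (hG _)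
  induction s using Finset.induction_on_max with
  | empty => simp
  | insert x s hx ih =>
    have hxs : x ∉ s := fun h => lt_irrefl _ (hx x h)
    rw [Finset.card_insert_of_notMem hxs, Finset.prod_insert hxs, Finset.prod_range_succ, mul_comm]
    refine mul_dvd_mul (hmono ?_) ih
    simpa using Finset.card_le_card fun y hy => Finset.mem_range.2 (hx y hy)

theorem prod_range_dvd_prod_comp {M ι : Type*} [CommMonoid M] {G : ℕ → M}
    (hG : ∀ i, G i ∣ G (i + 1)) (s : Finset ι) {c : ι → ℕ} (hc : Function.Injective c) :
    ∏ i ∈ Finset.range s.card, G i ∣ ∏ i ∈ s, G (c i) := by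
  classical
  have := prod_range_dvd_prod hG (s.image c)
  rwa [Finset.card_image_of_injective _ hc, Finset.prod_image fun _ _ _ _ h => hc h] at this

theorem numWeight_dvd_succ (N : S) (n k : ℕ) : numWeight N n k ∣ numWeight N n (k + 1) :=
  Finset.prod_dvd_prod_of_subset _ _ _ (Finset.range_subset_range.2 (by omega))

theorem denWeight_dvd_succ (h N : S) (k : ℕ) : denWeight h N k ∣ denWeight h N (k + 1) :=
  Finset.prod_dvd_prod_of_subset _ _ _ (Finset.range_subset_range.2 (by omega))

/-- In each term of the Leibniz formula the rows in `A` meet distinct columns, and the weights of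
distinct columns form chains for divisibility. -/
theorem pPoly_dvd_det (h N : S) (n : ℕ) (A : Finset (Fin n)) (g : Fin n → S[X]) :
    pPoly h N n A.card ∣ (polyMatrix h N n A g).det := by
  rw [Matrix.det_apply]
  refine Finset.dvd_sum fun σ _ => ?_
  rw [Units.smul_def, zsmul_eq_mul]
  refine Dvd.dvd.mul_left ?_ _
  simp only [polyMatrix, Matrix.of_apply]
  rw [Finset.prod_mul_distrib]
  refine Dvd.dvd.mul_right ?_ _
  rw [← Finset.prod_filter, Finset.prod_mul_distrib, mul_comm, pPoly, Finset.prod_mul_distrib]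
  have hcard : A.card = (Finset.univ.filter fun i => σ i ∈ A).card := by
    rw [← Finset.card_map σ.symm.toEmbedding]
    congr 1
    ext i
    simp [Finset.mem_map_equiv]
  rw [hcard]
  refine mul_dvd_mul
    (prod_range_dvd_prod_comp (denWeight_dvd_succ h N) _ Fin.val_injective)
    (prod_range_dvd_prod_comp (numWeight_dvd_succ N n) _ (c := fun i : Fin n => n - 1 - (i : ℕ)) ?_)
  intro i j hij
  simp only at hij
  omega

/-! ### Divisibility by `q` -/

/-- At the point where `θ_{x-2c-1} = θ_{x-2c'-1}`, the weights of the columns `c` and `c'` agree: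
the two products over integer shifts differ by a common block. -/
theorem eval_weight_eq (h N : S) (n c c' : ℕ) (hcc : c < c') (hc' : c' < n) :
    (numWeight N n (n - 1 - c) * denWeight h N c).eval ((c : S) + c' + 2 - h)
      = (numWeight N n (n - 1 - c') * denWeight h N c').eval ((c : S) + c' + 2 - h) := by
  obtain ⟨d, rfl⟩ := Nat.exists_eq_add_of_lt hcc
  obtain ⟨e, rfl⟩ := Nat.exists_eq_add_of_lt hc'
  have e1 : c + d + 1 + e + 1 - 1 - c = e + (d + 1) := by omega
  have e2 : c + d + 1 + e + 1 - 1 - (c + d + 1) = e := by omega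
  have key : ∀ k : ℕ, ∀ F : ℕ → S, ∏ r ∈ Finset.range (2 * k), -F r
      = ∏ r ∈ Finset.range (2 * k), F r := by
    intro k F
    rw [Finset.prod_neg]; simp
  rw [e1, e2, numWeight, numWeight, denWeight, denWeight, mul_add, add_assoc c d 1, mul_add 2 c,
    Finset.prod_range_add, Finset.prod_range_add]
  simp only [eval_mul, eval_prod, eval_sub, eval_X, eval_C]
  rw [mul_assoc, mul_comm (∏ x ∈ Finset.range (2 * c), _)]
  congr 2
  rw [← key]
  refine Finset.prod_congr rfl fun r _ => ?_
  push_cast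
  ring

theorem dvd_comp_node_sub (h : S) (c c' : ℕ) (g : S[X]) :
    (X - C ((c : S) + c' + 2 - h)) ∣ g.comp (node h c) - g.comp (node h c') := by
  have h1 : node h c - node h c' = (X - C ((c : S) + c' + 2 - h)) * C (4 * ((c' : S) - c)) := by
    simp only [node, map_sub, map_add, map_mul, map_natCast, map_ofNat, map_one]
    ring
  refine (Dvd.intro _ h1.symm).trans ?_
  simpa only [comp, eval₂_eq_eval_map] using
    sub_dvd_eval_sub (node h c) (node h c') (g.map C)

theorem dvd_polyMatrix_sub (h N : S) (n : ℕ) (A : Finset (Fin n)) (g : Fin n → S[X])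
    (i c c' : Fin n) (hcc : c < c') :
    (X - C ((c : S) + (c' : ℕ) + 2 - h)) ∣
      polyMatrix h N n A g i c - polyMatrix h N n A g i c' := by
  simp only [polyMatrix, Matrix.of_apply]
  have h2 := dvd_comp_node_sub h c c' (g i)
  split_ifs with hi
  · have h1 : (X - C ((c : S) + (c' : ℕ) + 2 - h)) ∣
        numWeight N n (n - 1 - c) * denWeight h N c
          - numWeight N n (n - 1 - c') * denWeight h N c' := by
      rw [dvd_iff_isRoot, IsRoot, eval_sub, eval_weight_eq h N n c c' hcc c'.2, sub_self]
    have := dvd_add (h1.mul_right ((g i).comp (node h c)))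
      (h2.mul_left (numWeight N n (n - 1 - c') * denWeight h N c'))
    refine this.trans (dvd_of_eq ?_)
    ring
  · simpa using h2

/-- Each pair of columns `c < c'` with `c + c' + 2 = s` contributes a factor `x - s + h`: the pairs
with the same `s` are disjoint, so column `c'` can be subtracted from column `c` in all of them at
once. -/
theorem pow_dvd_det (h N : S) (n : ℕ) (A : Finset (Fin n)) (g : Fin n → S[X]) (s : ℕ) :
    (X - C ((s : S) - h)) ^
        (Finset.univ.filter fun c : Fin n => 2 * (c : ℕ) + 2 < s ∧ s ≤ n + c + 1).card ∣
      (polyMatrix h N n A g).det := by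
  classical
  set M := polyMatrix h N n A g with hM
  set T := Finset.univ.filter fun c : Fin n => 2 * (c : ℕ) + 2 < s ∧ s ≤ n + c + 1 with hT
  let E : Matrix (Fin n) (Fin n) S[X] := Matrix.of fun c' c =>
    (if c' = c then 1 else 0) - (if c < c' ∧ (c : ℕ) + c' + 2 = s then 1 else 0)
  have hE : E.det = 1 := by
    rw [Matrix.det_of_isLowerTriangular]
    · exact Finset.prod_eq_one fun i _ => by simp [E]
    · intro i j hij
      have hij : i < j := hij
      simp [E, hij.ne, hij.not_gt]
  have hdvd : ∀ i c, c ∈ T → (X - C ((s : S) - h)) ∣ (M * E) i c := by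
    intro i c hc
    simp only [hT, Finset.mem_filter, Finset.mem_univ, true_and] at hc
    let c' : Fin n := ⟨s - 2 - c, by omega⟩
    have hval : (c' : ℕ) = s - 2 - c := rfl
    have hME : (M * E) i c = M i c - M i c' := by
      rw [Matrix.mul_apply]
      simp only [E, Matrix.of_apply, mul_sub, Finset.sum_sub_distrib, mul_ite, mul_one, mul_zero,
        Finset.sum_ite_eq', Finset.mem_univ, if_true]
      congr 1
      rw [Finset.sum_eq_single c']
      · rw [if_pos]
        constructor
        · rw [Fin.lt_def]; omega
        · omega
      · intro b _ hb
        rw [if_neg]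
        rintro ⟨_, hb'⟩
        exact hb (Fin.ext (by omega))
      · simp
    rw [hME]
    have := dvd_polyMatrix_sub h N n A g i c c' (by rw [Fin.lt_def]; omega)
    convert this using 4
    have : s = (c : ℕ) + c' + 2 := by omega
    rw [this]; push_cast; ring
  have hdet : M.det = (M * E).det := by rw [Matrix.det_mul, hE, mul_one]
  rw [hdet]
  choose! Q hQ using hdvd
  have hfac : M * E = Matrix.of fun i c => (if c ∈ T then X - C ((s : S) - h) else 1) *
      (Matrix.of fun i c => if c ∈ T then Q i c else (M * E) i c) i c := by
    ext1 i c
    by_cases hc : c ∈ T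
    · simp [hc, hQ i c hc]
    · simp [hc]
  rw [hfac, Matrix.det_mul_row, ← Finset.prod_filter]
  simp

/-- The multiplicity of the factor with index `s` in `q` is at most the number of pairs of columns
`c < c'` with `c + c' + 2 = s`, which are counted by `c`. -/
theorem card_le_card_pairs (n s : ℕ) :
    ((Finset.Icc 1 (n / 2)).filter fun i => 2 * i + 1 ≤ s ∧ s ≤ 2 * n - 2 * i + 1).card ≤
      (Finset.univ.filter fun c : Fin n => 2 * (c : ℕ) + 2 < s ∧ s ≤ n + c + 1).card := by
  refine Finset.card_le_card_of_surjOn (fun c : Fin n => (s + 1) / 2 - 1 - (c : ℕ)) ?_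
  intro i hi
  simp only [Finset.coe_filter, Finset.mem_Icc, Set.mem_ofPred_eq] at hi
  refine ⟨⟨(s + 1) / 2 - 1 - i, by omega⟩, ?_, ?_⟩
  · simp only [Finset.coe_filter, Finset.mem_univ, true_and, Set.mem_ofPred_eq]
    omega
  · simp only
    omega

theorem qPoly_eq_prod_pow (h : S) (n : ℕ) :
    qPoly h n = ∏ s ∈ Finset.range (2 * n), (X - C ((s : S) - h)) ^
      ((Finset.Icc 1 (n / 2)).filter fun i => 2 * i + 1 ≤ s ∧ s ≤ 2 * n - 2 * i + 1).card := by
  rw [qPoly, Finset.prod_comm' (t' := Finset.range (2 * n))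
    (s' := fun s => (Finset.Icc 1 (n / 2)).filter fun i => 2 * i + 1 ≤ s ∧ s ≤ 2 * n - 2 * i + 1)]
  · exact Finset.prod_congr rfl fun s _ => Finset.prod_const _
  · intro i s
    simp only [Finset.mem_Icc, Finset.mem_filter, Finset.mem_range]
    omega

end Generic

/-! ### Divisibility by `p q` -/

section Field

variable {K : Type*} [Field K]

theorem qPoly_dvd_det [CharZero K] (h N : K) (n : ℕ) (A : Finset (Fin n)) (g : Fin n → K[X]) :
    qPoly h n ∣ (polyMatrix h N n A g).det := by
  rw [qPoly_eq_prod_pow]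
  refine Finset.prod_dvd_of_coprime (fun s _ t _ hst => ?_) fun s _ =>
    (pow_dvd_pow _ (card_le_card_pairs n s)).trans (pow_dvd_det h N n A g s)
  exact (pairwise_coprime_X_sub_C (s := fun s : ℕ => (s : K) - h)
    (fun i j hij => by simpa using hij) hst).pow

theorem isCoprime_pPoly_qPoly {h N : K} (h1 : ∀ z : ℤ, N ≠ z - h) (n k : ℕ) :
    IsCoprime (pPoly h N n k) (qPoly h n) := by
  have hne : ∀ {x y : K}, x ≠ y → IsCoprime (X - C x) (X - C y) := fun hxy =>
    isCoprime_X_sub_C_of_isUnit_sub (sub_ne_zero.2 hxy).isUnit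
  refine IsCoprime.prod_left fun j _ => IsCoprime.prod_right fun i _ =>
    IsCoprime.prod_right fun s _ => IsCoprime.mul_left
      (IsCoprime.prod_left fun r _ => hne fun hr => h1 (3 + r - s) ?_)
      (IsCoprime.prod_left fun r _ => hne fun hr => h1 (s - 2 * n + 1 + r) ?_)
  · push_cast; linear_combination -hr
  · push_cast; linear_combination hr

theorem pPoly_mul_qPoly_dvd_det_of_generic [CharZero K] {h N : K} (h1 : ∀ z : ℤ, N ≠ z - h) (n : ℕ)
    (A : Finset (Fin n)) (g : Fin n → K[X]) :
    pPoly h N n A.card * qPoly h n ∣ (polyMatrix h N n A g).det :=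
  (isCoprime_pPoly_qPoly h1 n _).mul_dvd (pPoly_dvd_det h N n A g) (qPoly_dvd_det h N n A g)

/-- The divisibility for a generic parameter specializes to all values: `p` and `q` may have common
roots if `N + h` is an integer, so `N` is first replaced by an indeterminate `T`, and the quotient,
which has coefficients in `K[T]` as the divisor is monic, is then evaluated at `T = N`. -/
theorem pPoly_mul_qPoly_dvd_det [CharZero K] (h N : K) (n : ℕ) (A : Finset (Fin n))
    (g : Fin n → K[X]) :
    pPoly h N n A.card * qPoly h n ∣ (polyMatrix h N n A g).det := by
  let ι : K[X] →+* RatFunc K := algebraMap K[X] (RatFunc K)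
  have hι : Function.Injective ι := IsFractionRing.injective K[X] (RatFunc K)
  have : CharZero (RatFunc K) :=
    charZero_of_injective_algebraMap (algebraMap K (RatFunc K)).injective
  have hgen : pPoly (C h) X n A.card * qPoly (C h) n ∣
      (polyMatrix (C h) X n A fun i => (g i).map C).det := by
    rw [← map_dvd_map ι hι ((monic_pPoly _ _ _ _).mul (monic_qPoly _ _)), Polynomial.map_mul,
      map_pPoly, map_qPoly, map_det_polyMatrix]
    refine pPoly_mul_qPoly_dvd_det_of_generic (fun z hz => ?_) n A _
    have hz' : ι X = ι (C ((z : K) - h)) := by simpa using hz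
    have := congrArg natDegree (hι hz')
    rw [natDegree_X, natDegree_C] at this
    exact one_ne_zero this
  have := Polynomial.map_dvd (evalRingHom N) hgen
  rw [Polynomial.map_mul, map_pPoly, map_qPoly, map_det_polyMatrix] at this
  have hg : ∀ f : K[X], (f.map C).map (evalRingHom N) = f := fun f => by
    rw [Polynomial.map_map, show (evalRingHom N).comp C = RingHom.id K from
      RingHom.ext fun x => eval_C, Polynomial.map_id]
  simpa [hg] using this

end Field

/-! ### Leading coefficients of determinants -/

section Leads

variable {S : Type*} [CommRing S]

/-- `f` has degree at most `e`, and `α`, possibly zero, is its coefficient of degree `e`. -/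
def LeadsAt (f : S[X]) (e : ℕ) (α : S) : Prop := f.natDegree ≤ e ∧ f.coeff e = α

theorem LeadsAt.mul {f g : S[X]} {d e : ℕ} {α β : S} (hf : LeadsAt f d α) (hg : LeadsAt g e β) :
    LeadsAt (f * g) (d + e) (α * β) :=
  ⟨natDegree_mul_le_of_le hf.1 hg.1, by rw [coeff_mul_add_eq_of_natDegree_le hf.1 hg.1, hf.2, hg.2]⟩

theorem LeadsAt.add {f g : S[X]} {e : ℕ} {α β : S} (hf : LeadsAt f e α) (hg : LeadsAt g e β) :
    LeadsAt (f + g) e (α + β) :=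
  ⟨natDegree_add_le_of_degree_le hf.1 hg.1, by rw [coeff_add, hf.2, hg.2]⟩

theorem leadsAt_zero (e : ℕ) : LeadsAt (0 : S[X]) e 0 := by simp [LeadsAt]

theorem LeadsAt.sum {ι : Type*} {s : Finset ι} {f : ι → S[X]} {e : ℕ} {α : ι → S}
    (hf : ∀ i ∈ s, LeadsAt (f i) e (α i)) : LeadsAt (∑ i ∈ s, f i) e (∑ i ∈ s, α i) :=
  ⟨natDegree_sum_le_of_forall_le s f fun i hi => (hf i hi).1, by
    rw [finsetSum_coeff]; exact Finset.sum_congr rfl fun i hi => (hf i hi).2⟩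

theorem LeadsAt.prod {ι : Type*} (s : Finset ι) {f : ι → S[X]} {e : ι → ℕ} {α : ι → S}
    (hf : ∀ i ∈ s, LeadsAt (f i) (e i) (α i)) :
    LeadsAt (∏ i ∈ s, f i) (∑ i ∈ s, e i) (∏ i ∈ s, α i) := by
  classical
  induction s using Finset.induction_on with
  | empty => simp [LeadsAt]
  | insert i s hi ih =>
    rw [Finset.prod_insert hi, Finset.prod_insert hi, Finset.sum_insert hi]
    exact (hf i (Finset.mem_insert_self _ _)).mul
      (ih fun j hj => hf j (Finset.mem_insert_of_mem hj))

theorem LeadsAt.det {n : ℕ} {M : Matrix (Fin n) (Fin n) S[X]} {e : Fin n → ℕ}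
    {c : Matrix (Fin n) (Fin n) S} (hM : ∀ i j, LeadsAt (M i j) (e i) (c i j)) :
    LeadsAt M.det (∑ i, e i) c.det := by
  rw [Matrix.det_apply', Matrix.det_apply']
  refine LeadsAt.sum fun σ _ => ?_
  have h1 : LeadsAt (((Equiv.Perm.sign σ : ℤ) : S[X])) 0 ((Equiv.Perm.sign σ : ℤ) : S) := by
    constructor
    · exact (natDegree_intCast _).le
    · exact intCast_coeff_zero
  have h2 : LeadsAt (∏ i, M (σ i) i) (∑ i, e (σ i)) (∏ i, c (σ i) i) :=
    LeadsAt.prod _ fun i _ => hM (σ i) i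
  rw [Equiv.sum_comp σ e] at h2
  simpa using h1.mul h2

theorem leadsAt_of_monic {f : S[X]} (hf : f.Monic) {e : ℕ} (he : f.natDegree = e) :
    LeadsAt f e 1 := ⟨he.le, he ▸ hf⟩

theorem leadsAt_taylor_sub (r : S) {f : S[X]} {d : ℕ} {α : S} (hf : LeadsAt f (d + 1) α) :
    LeadsAt (taylor r f - f) d ((d + 1) * r * α) := by
  -- For `i ≥ d`, only two terms of the binomial expansion of the shift reach degree `i`.
  have hc : ∀ i, d < i + 1 → (taylor r f).coeff i = f.coeff i + (i + 1) * f.coeff (i + 1) * r := by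
    intro i hi
    have hdeg : (hasseDeriv i f).natDegree ≤ 1 :=
      (natDegree_hasseDeriv_le f i).trans (by have := hf.1; omega)
    rw [taylor_coeff, eq_X_add_C_of_natDegree_le_one hdeg]
    simp only [eval_add, eval_mul, eval_C, eval_X, hasseDeriv_coeff]
    simp
    rw [add_comm 1 i, Nat.choose_succ_self_right]
    push_cast
    ring
  constructor
  · rw [natDegree_le_iff_coeff_eq_zero]
    intro i hi
    have h0 : f.coeff (i + 1) = 0 :=
      coeff_eq_zero_of_natDegree_lt (by have := hf.1; omega)
    rw [coeff_sub, hc i (by omega), h0]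
    ring
  · rw [coeff_sub, hc d (by omega), hf.2]
    ring

theorem LeadsAt.of_X_pow_mul {f : S[X]} {l d : ℕ} {α : S} (hf : LeadsAt (X ^ l * f) (d + l) α) :
    LeadsAt f d α := by
  constructor
  · rw [natDegree_le_iff_coeff_eq_zero]
    intro i hi
    rw [← coeff_X_pow_mul f l i]
    exact coeff_eq_zero_of_natDegree_lt (by have := hf.1; omega)
  · rw [← coeff_X_pow_mul f l d, hf.2]

theorem leadsAt_X_pow (k : ℕ) : LeadsAt (X ^ k : S[X]) k 1 :=
  ⟨natDegree_X_pow_le k, by simp⟩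

/-- The factor `x ^ l` allows a common statement for the differences of order `l` that vanish for
reasons of degree. -/
theorem leadsAt_X_pow_mul_taylor_sub (r : S) {f : S[X]} {l e : ℕ} {α : S}
    (hf : LeadsAt (X ^ l * f) e α) :
    LeadsAt (X ^ (l + 1) * (taylor r f - f)) e (r * ((e : S) - l) * α) := by
  rcases lt_trichotomy l e with h | rfl | h
  · obtain ⟨d, rfl⟩ := Nat.exists_eq_add_of_lt h
    have h1 : LeadsAt f (d + 1) α := LeadsAt.of_X_pow_mul (l := l) (by
      rwa [show d + 1 + l = l + d + 1 by omega])
    have h2 := (leadsAt_X_pow (l + 1)).mul (leadsAt_taylor_sub r h1)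
    rw [show l + 1 + d = l + d + 1 by omega] at h2
    convert h2 using 1
    push_cast; ring
  · have h1 : LeadsAt f 0 α := LeadsAt.of_X_pow_mul (l := l) (by rwa [zero_add])
    rw [eq_C_of_natDegree_le_zero h1.1]
    simpa using leadsAt_zero l
  · have h1 : α = 0 := by
      rw [← hf.2, coeff_X_pow_mul', if_neg (by omega)]
    have h2 : f = 0 := by
      ext i
      rw [← coeff_X_pow_mul f l i, coeff_zero]
      exact coeff_eq_zero_of_natDegree_lt (by have := hf.1; omega)
    rw [h1, h2]
    simpa using leadsAt_zero e

/-- The terms of degree `d + 2` cancel, since both quadratic factors are monic. -/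
theorem leadsAt_weighted_difference {f : S[X]} {d : ℕ} {α : S} (hf : LeadsAt f d α)
    (a₁ a₂ b₁ b₂ : S) :
    LeadsAt ((X - C a₁) * (X - C a₂) * taylor (-2) f - (X - C b₁) * (X - C b₂) * f) (d + 1)
      ((b₁ + b₂ - a₁ - a₂ - 2 * d) * α) := by
  have hX : ∀ a : S, LeadsAt (X - C a) 1 1 := fun a => ⟨natDegree_X_sub_C_le a, by simp⟩
  have h1 : LeadsAt ((X - C a₁) * (X - C a₂) * (taylor (-2) f - f)) (d + 1) (-2 * d * α) := by
    cases d with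
    | zero =>
      rw [eq_C_of_natDegree_le_zero hf.1]
      simpa using leadsAt_zero 1
    | succ d =>
      have := ((hX a₁).mul (hX a₂)).mul (leadsAt_taylor_sub (-2) hf)
      rw [show 1 + 1 + d = d + 1 + 1 by omega] at this
      convert this using 1
      push_cast; ring
  have h2 : LeadsAt (C (b₁ + b₂ - a₁ - a₂) * X + C (a₁ * a₂ - b₁ * b₂)) 1 (b₁ + b₂ - a₁ - a₂) :=
    ⟨natDegree_linear_le, by simp⟩
  have h3 := h2.mul hf
  rw [add_comm 1 d] at h3
  convert h1.add h3 using 1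
  · simp only [map_add, map_sub, map_mul]
    ring
  · ring

/-- A determinant does not change when its columns are replaced by their iterated differences. -/
theorem det_eq_det_fwdDiff {n : ℕ} (R : Fin n → ℕ → S) :
    (Matrix.of fun i c : Fin n => R i c).det =
      (Matrix.of fun i l : Fin n => (fwdDiff 1)^[(l : ℕ)] (R i) 0).det := by
  -- The coefficients of the iterated differences form a unipotent triangular matrix.
  let E : Matrix (Fin n) (Fin n) S := Matrix.of fun c l =>
    (((-1) ^ ((l : ℕ) - c) * (l : ℕ).choose c : ℤ) : S)
  have hE : E.det = 1 := by
    rw [Matrix.det_of_isUpperTriangular]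
    · exact Finset.prod_eq_one fun i _ => by simp [E]
    · intro i j hij
      have hij : (j : ℕ) < i := hij
      simp [E, Nat.choose_eq_zero_of_lt hij]
  have hM : (Matrix.of fun i l : Fin n => (fwdDiff 1)^[(l : ℕ)] (R i) 0)
      = (Matrix.of fun i c : Fin n => R i c) * E := by
    ext i l
    rw [Matrix.mul_apply, Matrix.of_apply, fwdDiff_iter_eq_sum_shift]
    simp only [Matrix.of_apply, E, zsmul_eq_mul, zero_add, smul_eq_mul, mul_one]
    rw [Fin.sum_univ_eq_sum_range (fun c => R i c *
      (((-1) ^ ((l : ℕ) - c) * (l : ℕ).choose c : ℤ) : S)) n]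
    rw [← Finset.sum_subset (Finset.range_subset_range.2 (show (l : ℕ) + 1 ≤ n from l.2))]
    · exact Finset.sum_congr rfl fun _ _ => mul_comm _ _
    · intro c _ hc
      rw [Finset.mem_range, not_lt] at hc
      rw [Nat.choose_eq_zero_of_lt hc]
      simp
  rw [hM, Matrix.det_mul, hE, mul_one]

end Leads

/-! ### Differences of the columns -/

section Differences

variable {S : Type*} [CommRing S]

/-- The unweighted part of the difference of order `l` of a weighted row, at the column `c = 0`. -/
noncomputable def weightedDiff (h N : S) (f : S[X]) : ℕ → S[X]
  | 0 => f
  | l + 1 =>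
    (X - C (3 - 2 * h - N)) * (X - C (4 - 2 * h - N)) * taylor (-2) (weightedDiff h N f l) -
      (X - C (N + 3 + 2 * l)) * (X - C (N + 2 + 2 * l)) * weightedDiff h N f l

theorem node_eq_taylor (h : S) (c : ℕ) : node h c = taylor (-(2 * (c : S))) (node h 0) := by
  simp only [node, taylor_apply, mul_comp, sub_comp, add_comp, X_comp, C_comp, Nat.cast_zero]
  simp only [map_sub, map_add, map_mul, map_neg, map_zero, map_one]
  ring

theorem comp_node_eq_taylor (h : S) (c : ℕ) (g : S[X]) :
    g.comp (node h c) = taylor (-(2 * (c : S))) (g.comp (node h 0)) := by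
  rw [node_eq_taylor, taylor_apply, taylor_apply, comp_assoc]

theorem fwdDiff_iter_unweighted (f : S[X]) (l c : ℕ) :
    (fwdDiff 1)^[l] (fun c : ℕ => taylor (-(2 * (c : S))) f) c =
      taylor (-(2 * (c : S))) ((fun p => taylor (-2) p - p)^[l] f) := by
  induction l generalizing c with
  | zero => rfl
  | succ l ih =>
    rw [Function.iterate_succ_apply', Function.iterate_succ_apply', fwdDiff, ih, ih, map_sub,
      taylor_taylor]
    congr 3
    push_cast; ring

/-- Each difference removes two factors from the numerator part of the weight. -/
theorem fwdDiff_iter_weighted (h N : S) (n : ℕ) (f : S[X]) (l c : ℕ) (hlc : c + l < n) :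
    (fwdDiff 1)^[l] (fun c : ℕ => numWeight N n (n - 1 - c) * denWeight h N c *
        taylor (-(2 * (c : S))) f) c =
      numWeight N n (n - 1 - c - l) * denWeight h N c *
        taylor (-(2 * (c : S))) (weightedDiff h N f l) := by
  induction l generalizing c with
  | zero => rfl
  | succ l ih =>
    obtain ⟨k, rfl⟩ := Nat.exists_eq_add_of_lt hlc
    rw [Function.iterate_succ_apply', fwdDiff, ih _ (by omega), ih _ (by omega)]
    rw [show c + (l + 1) + k + 1 - 1 - (c + 1) - l = k by omega,
      show c + (l + 1) + k + 1 - 1 - c - l = k + 1 by omega,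
      show c + (l + 1) + k + 1 - 1 - c - (l + 1) = k by omega]
    have hn : numWeight N (c + (l + 1) + k + 1) (k + 1) = numWeight N (c + (l + 1) + k + 1) k *
        ((X - C (2 * c + N + 3 + 2 * l)) * (X - C (2 * c + N + 2 + 2 * l))) := by
      rw [numWeight, mul_add, Finset.prod_range_add, Finset.prod_range_succ, Finset.prod_range_one,
        numWeight]
      congr 4 <;> · push_cast; ring
    have hd : denWeight h N (c + 1) = denWeight h N c *
        ((X - C (3 - 2 * h - N + 2 * c)) * (X - C (4 - 2 * h - N + 2 * c))) := by
      rw [denWeight, mul_add, Finset.prod_range_add, Finset.prod_range_succ, Finset.prod_range_one,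
        denWeight]
      congr 4 <;> · push_cast; ring
    have ht : taylor (-(2 * ((c + 1 : ℕ) : S))) (weightedDiff h N f l)
        = taylor (-(2 * (c : S))) (taylor (-2) (weightedDiff h N f l)) := by
      rw [taylor_taylor]; congr 2; push_cast; ring
    rw [hn, hd, ht, weightedDiff]
    simp only [map_sub, taylor_mul, taylor_X, taylor_C]
    simp only [map_sub, map_add, map_mul, map_neg]
    ring

theorem leadsAt_weightedDiff (h N : S) {f : S[X]} {d : ℕ} {α : S} (hf : LeadsAt f d α) (l : ℕ) :
    LeadsAt (weightedDiff h N f l) (d + l)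
      (α * ((-2) ^ l * (descPochhammer S l).eval ((d : S) - 2 * N - 2 * h + 1))) := by
  induction l with
  | zero => simpa [weightedDiff] using hf
  | succ l ih =>
    have := leadsAt_weighted_difference ih (3 - 2 * h - N) (4 - 2 * h - N) (N + 3 + 2 * l)
      (N + 2 + 2 * l)
    rw [descPochhammer_succ_eval, weightedDiff, ← add_assoc]
    convert this using 1
    push_cast; ring

theorem leadsAt_unweightedDiff {f : S[X]} {d : ℕ} {α : S} (hf : LeadsAt f d α) (l : ℕ) :
    LeadsAt (X ^ l * (fun p => taylor (-2) p - p)^[l] f) d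
      (α * ((-2) ^ l * (descPochhammer S l).eval (d : S))) := by
  induction l with
  | zero => simpa using hf
  | succ l ih =>
    rw [Function.iterate_succ_apply', descPochhammer_succ_eval]
    convert leadsAt_X_pow_mul_taylor_sub (-2) ih using 1
    ring

end Differences

/-! ### The degree of the determinant -/

section Field

variable {K : Type*} [Field K]

theorem natDegree_numWeight (N : K) (n k : ℕ) : (numWeight N n k).natDegree = 2 * k := by
  rw [numWeight, natDegree_prod_of_monic _ _ fun _ _ => monic_X_sub_C _]
  simp only [natDegree_X_sub_C, Finset.sum_const, Finset.card_range, smul_eq_mul, mul_one]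

theorem natDegree_denWeight (h N : K) (k : ℕ) : (denWeight h N k).natDegree = 2 * k := by
  rw [denWeight, natDegree_prod_of_monic _ _ fun _ _ => monic_X_sub_C _]
  simp only [natDegree_X_sub_C, Finset.sum_const, Finset.card_range, smul_eq_mul, mul_one]

theorem leadsAt_comp_node (h : K) (g : K[X]) :
    LeadsAt (g.comp (node h 0)) (2 * g.natDegree) g.leadingCoeff := by
  have hn : (node h 0).natDegree = 2 := by
    rw [node]; compute_degree!
  have hm : (node h 0).Monic := by
    rw [node]; monicity!
  have hd : (g.comp (node h 0)).natDegree = 2 * g.natDegree := by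
    rw [natDegree_comp, hn, mul_comm]
  refine ⟨hd.le, ?_⟩
  rw [← hd, coeff_natDegree, leadingCoeff_comp (by omega), hm.leadingCoeff, one_pow, mul_one]

theorem det_descPochhammer (n : ℕ) (κ ε : Fin n → K) :
    (Matrix.of fun i l : Fin n =>
      κ i * ((-2) ^ (l : ℕ) * (descPochhammer K l).eval (ε i))).det =
      (∏ i, κ i) * ((∏ l : Fin n, (-2) ^ (l : ℕ)) * (Matrix.vandermonde ε).det) := by
  rw [Matrix.det_eval_matrixOfPolynomials_eq_det_vandermonde ε (fun l => descPochhammer K l)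
    (fun i => descPochhammer_natDegree K i) (fun i => monic_descPochhammer K i),
    ← Matrix.det_mul_row, ← Matrix.det_mul_column]
  rfl

/-- Seen as a function of `x - 2c`, a row of degree `d` in the nodes behaves like the power with
exponent `ε = 2d` if it is unweighted and, up to a factor common to all columns,
`ε = 2d - 2N - 2h + 1` if it is weighted. The leading coefficient of the determinant of the iterated
differences is, up to a nonzero constant, the Vandermonde determinant of the `ε`. -/
theorem natDegree_det_polyMatrix [CharZero K] (h N : K) (n : ℕ) (A : Finset (Fin n))
    (g : Fin n → K[X]) (hg : ∀ i, g i ≠ 0)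
    (hε : Function.Injective fun i =>
      (2 * (g i).natDegree : K) + if i ∈ A then -2 * N - 2 * h + 1 else 0) :
    (polyMatrix h N n A g).det ≠ 0 ∧
      (polyMatrix h N n A g).det.natDegree + n.choose 2 =
        ∑ i, (2 * (g i).natDegree + if i ∈ A then 2 * (n - 1) else 0) := by
  set ε : Fin n → K := fun i =>
    (2 * (g i).natDegree : K) + if i ∈ A then -2 * N - 2 * h + 1 else 0 with hεdef
  let R : Fin n → ℕ → K[X] := fun i c =>
    (if i ∈ A then numWeight N n (n - 1 - c) * denWeight h N c else 1) *
      taylor (-(2 * (c : K))) ((g i).comp (node h 0))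
  have hdet : (polyMatrix h N n A g).det =
      (Matrix.of fun i l : Fin n => (fwdDiff 1)^[(l : ℕ)] (R i) 0).det := by
    rw [← det_eq_det_fwdDiff R]
    congr 1
    ext1 i c
    simp only [polyMatrix, Matrix.of_apply, R, comp_node_eq_taylor h c]
  have hlead : ∀ i l : Fin n, LeadsAt (X ^ (l : ℕ) * (fwdDiff 1)^[(l : ℕ)] (R i) 0)
      (2 * (g i).natDegree + if i ∈ A then 2 * (n - 1) else 0)
      ((g i).leadingCoeff * ((-2) ^ (l : ℕ) * (descPochhammer K l).eval (ε i))) := by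
    intro i l
    have h0 := leadsAt_comp_node h (g i)
    by_cases hi : i ∈ A
    · simp only [R, hεdef, if_pos hi]
      rw [fwdDiff_iter_weighted h N n _ l 0 (by omega)]
      have h1 := (leadsAt_X_pow (S := K) l).mul
        (((leadsAt_of_monic (monic_numWeight N n (n - 1 - l)) (natDegree_numWeight _ _ _)).mul
        (leadsAt_of_monic (monic_denWeight h N 0) (natDegree_denWeight _ _ _))).mul
        (leadsAt_weightedDiff h N h0 l))
      convert h1 using 1
      · simp
      · omega
      · push_cast
        simp only [one_mul]
        rw [show (2 * ((g i).natDegree : K)) + (-2 * N - 2 * h + 1)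
          = 2 * ((g i).natDegree : K) - 2 * N - 2 * h + 1 by ring]
    · simp only [R, hεdef, if_neg hi, one_mul, add_zero]
      have h1 := leadsAt_unweightedDiff h0 l
      rw [fwdDiff_iter_unweighted]
      convert h1 using 1
      · simp
      · push_cast; rfl
  -- The powers of `x` bring all entries of a row to the same formal degree.
  have hdet' : LeadsAt (X ^ n.choose 2 * (polyMatrix h N n A g).det)
      (∑ i, (2 * (g i).natDegree + if i ∈ A then 2 * (n - 1) else 0))
      ((∏ i, (g i).leadingCoeff) *
        ((∏ l : Fin n, (-2) ^ (l : ℕ)) * (Matrix.vandermonde ε).det)) := by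
    have hX : ∏ l : Fin n, (X : K[X]) ^ (l : ℕ) = X ^ n.choose 2 := by
      rw [Finset.prod_pow_eq_pow_sum, Fin.sum_univ_eq_sum_range fun i => i,
        Finset.sum_range_id, Nat.choose_two_right]
    rw [hdet, ← hX, ← Matrix.det_mul_row, ← det_descPochhammer]
    exact LeadsAt.det hlead
  have hne : (∏ i, (g i).leadingCoeff) *
      ((∏ l : Fin n, (-2 : K) ^ (l : ℕ)) * (Matrix.vandermonde ε).det) ≠ 0 := by
    refine mul_ne_zero (Finset.prod_ne_zero_iff.2 fun i _ => leadingCoeff_ne_zero.2 (hg i))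
      (mul_ne_zero (Finset.prod_ne_zero_iff.2 fun i _ => pow_ne_zero _ (by norm_num)) ?_)
    exact Matrix.det_vandermonde_ne_zero_iff.2 hε
  have h0 : (polyMatrix h N n A g).det ≠ 0 := by
    intro h0
    rw [h0, mul_zero] at hdet'
    exact hne (by rw [← hdet'.2, coeff_zero])
  refine ⟨h0, ?_⟩
  have h1 := natDegree_eq_of_le_of_coeff_ne_zero hdet'.1 (hdet'.2.symm ▸ hne)
  rwa [natDegree_mul (pow_ne_zero _ X_ne_zero) h0, natDegree_X_pow, add_comm] at h1

theorem natDegree_pPoly (h N : K) (n k : ℕ) : (pPoly h N n k).natDegree = 4 * k.choose 2 := by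
  rw [pPoly, natDegree_prod_of_monic _ _ fun _ _ =>
    (monic_denWeight _ _ _).mul (monic_numWeight _ _ _)]
  simp only [(monic_denWeight h N _).natDegree_mul (monic_numWeight N n _), natDegree_denWeight,
    natDegree_numWeight]
  rw [Nat.choose_two_right, ← Finset.sum_range_id, Finset.mul_sum]
  exact Finset.sum_congr rfl fun _ _ => by ring

/-- The polynomial `q` has one factor for each pair of columns. -/
theorem natDegree_qPoly (h : K) (n : ℕ) : (qPoly h n).natDegree = n.choose 2 := by
  have key : ∀ k, 2 * k ≤ n → ∑ i ∈ Finset.Icc 1 k, (2 * n - 4 * i + 1) + k * (2 * k + 1)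
      = 2 * n * k := by
    intro k
    induction k with
    | zero => simp
    | succ k ih =>
      intro hk
      have := ih (by omega)
      rw [Finset.sum_Icc_succ_top (by omega)]
      have h1 : 2 * n - 4 * (k + 1) + 1 + (4 * k + 3) = 2 * n := by omega
      nlinarith
  rw [qPoly, natDegree_prod_of_monic _ _ fun _ _ =>
    monic_prod_of_monic _ _ fun _ _ => monic_X_sub_C _]
  have h1 : ∀ i ∈ Finset.Icc 1 (n / 2), (∏ s ∈ Finset.Icc (2 * i + 1) (2 * n - 2 * i + 1),
      (X - C ((s : K) - h))).natDegree = 2 * n - 4 * i + 1 := by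
    intro i hi
    rw [Finset.mem_Icc] at hi
    rw [natDegree_prod_of_monic _ _ fun _ _ => monic_X_sub_C _]
    simp only [natDegree_X_sub_C, Finset.sum_const, Nat.card_Icc, smul_eq_mul, mul_one]
    omega
  rw [Finset.sum_congr rfl h1]
  have h2 := key (n / 2) (by omega)
  have h3 := Nat.choose_two_right n
  have h4 : n.choose 2 * 2 = n * (n - 1) := by
    rw [h3, Nat.div_mul_cancel (Nat.even_mul_pred_self n).two_dvd]
  obtain ⟨k, rfl | rfl⟩ := Nat.even_or_odd' n
  · rw [show 2 * k / 2 = k by omega] at h2 ⊢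
    cases k with
    | zero => simp
    | succ k =>
      rw [show 2 * (k + 1) - 1 = 2 * k + 1 by omega] at h4
      nlinarith
  · rw [show (2 * k + 1) / 2 = k by omega] at h2 ⊢
    rw [show 2 * k + 1 - 1 = 2 * k by omega] at h4
    nlinarith

end Field

/-! ### Degrees of the dual Hahn polynomials -/

theorem natDegree_dualHahn {α β M : ℝ} {n : ℕ} (h : DualHahnDefined α M n) :
    (dualHahn α β M n).natDegree = n := by
  have hb : ∀ j, (∏ i ∈ Finset.range j, (X - C ((i : ℝ) * (α + β + 1 + (i : ℝ))))).Monic :=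
    fun j => monic_prod_of_monic _ _ fun _ _ => monic_X_sub_C _
  have hd : ∀ j, (∏ i ∈ Finset.range j, (X - C ((i : ℝ) * (α + β + 1 + (i : ℝ))))).natDegree = j :=
    fun j => by
      rw [natDegree_prod_of_monic _ _ fun _ _ => monic_X_sub_C _]
      simp only [natDegree_X_sub_C, Finset.sum_const, Finset.card_range, smul_eq_mul, mul_one]
  have hlead : LeadsAt (dualHahn α β M n) n (rpoch (-(n : ℝ)) n * (-1) ^ n /
      (rpoch (α + 1) n * rpoch (-M) n * (n.factorial : ℝ))) := by
    rw [dualHahn, Finset.sum_range_succ]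
    constructor
    · refine natDegree_add_le_of_degree_le
        (natDegree_sum_le_of_forall_le _ _ fun j hj => ?_)
        ((natDegree_C_mul_le _ _).trans (hd n).le)
      exact (natDegree_C_mul_le _ _).trans ((hd j).le.trans (Finset.mem_range.1 hj).le)
    · rw [coeff_add, finsetSum_coeff, Finset.sum_eq_zero, zero_add, coeff_C_mul]
      · have h1 :
            (∏ i ∈ Finset.range n, (X - C ((i : ℝ) * (α + β + 1 + (i : ℝ))))).coeff n = 1 := by
          have := (hb n).coeff_natDegree
          rwa [hd n] at this
        rw [h1, mul_one]
      · intro j hj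
        refine coeff_eq_zero_of_natDegree_lt (lt_of_le_of_lt (natDegree_C_mul_le _ _) ?_)
        rw [hd j]
        exact Finset.mem_range.1 hj
  refine natDegree_eq_of_le_of_coeff_ne_zero hlead.1 ?_
  rw [hlead.2]
  refine div_ne_zero (mul_ne_zero ?_ (by simp))
    (mul_ne_zero (mul_ne_zero h.1 h.2) (by exact_mod_cast n.factorial_ne_zero))
  rw [rpoch, Finset.prod_ne_zero_iff]
  intro i hi
  have : (i : ℝ) < n := by exact_mod_cast Finset.mem_range.1 hi
  linarith

theorem natDegree_polyY {a N : ℝ} {u : ℕ} (h : DualHahnDefined (-a) (2 * a + N) u) :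
    (polyY a N u).natDegree = u := by
  rw [polyY, natDegree_comp, natDegree_X_add_C, mul_one, natDegree_dualHahn h]

theorem natDegree_polyZ {a N : ℝ} {v : ℕ} (h : DualHahnDefined (-a) (-2 - N) v) :
    (polyZ a N v).natDegree = v := by
  rw [polyZ, natDegree_comp, natDegree_X_add_C, mul_one, natDegree_dualHahn h]

theorem dualHahn_zero (α β M : ℝ) : dualHahn α β M 0 = 1 := by
  simp [dualHahn, rpoch]

theorem dualHahn_ne_zero {α β M : ℝ} {n : ℕ} (h : DualHahnDefined α M n) :
    dualHahn α β M n ≠ 0 := by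
  rcases Nat.eq_zero_or_pos n with rfl | hn
  · rw [dualHahn_zero]; exact one_ne_zero
  · exact ne_zero_of_natDegree_gt (n := 0) (by rwa [natDegree_dualHahn h])

theorem polyY_ne_zero {a N : ℝ} {u : ℕ} (h : DualHahnDefined (-a) (2 * a + N) u) :
    polyY a N u ≠ 0 := by
  rw [polyY, ← taylor_apply, Ne, taylor_eq_zero]
  exact dualHahn_ne_zero h

theorem polyZ_ne_zero {a N : ℝ} {v : ℕ} (h : DualHahnDefined (-a) (-2 - N) v) :
    polyZ a N v ≠ 0 := by
  rw [polyZ, ← taylor_apply, Ne, taylor_eq_zero]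
  exact dualHahn_ne_zero h

/-! ### Clearing the denominators -/

section Clear

variable (a N : ℝ)

theorem denWeight_eq (k : ℕ) : denWeight (a + 3 / 2) N k =
    ∏ r ∈ Finset.range (2 * k), (X + C (2 * a + N + 1 - 2 * k) + (r : ℝ[X])) := by
  rw [denWeight, ← Finset.prod_range_reflect]
  refine Finset.prod_congr rfl fun r hr => ?_
  rw [Finset.mem_range] at hr
  rw [← C_eq_natCast, add_assoc, ← C_add, sub_eq_add_neg, ← C_neg, Nat.cast_sub (by omega),
    Nat.cast_sub (by omega)]
  congr 2
  push_cast; ring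

theorem numWeight_eq (n k : ℕ) : numWeight N n k =
    ∏ r ∈ Finset.range (2 * k), (X + C (1 - 2 * n - N) + (r : ℝ[X])) := by
  refine Finset.prod_congr rfl fun r _ => ?_
  rw [← C_eq_natCast, add_assoc, ← C_add, sub_eq_add_neg, ← C_neg]
  congr 2
  ring

/-- The row factor `D_{x-1,m-1} / N_{x-m+1,1}` turns `ξ` into the polynomial weight. -/
theorem denD_mul_numN (n c : ℕ) (hc : c < n) :
    denD a N (X - 1) (2 * n - 1) *
        numN N (X - 2 * ((c + 1 : ℕ) : ℝ[X]) + 1) (2 * n - 2 * (c + 1) + 1) =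
      numN N (X - ((2 * n : ℕ) : ℝ[X]) + 1) 1 *
        (numWeight N n (n - 1 - c) * denWeight (a + 3 / 2) N c) *
        denD a N (X - 2 * ((c + 1 : ℕ) : ℝ[X]) + 1) (2 * n - 2 * (c + 1) + 1) := by
  obtain ⟨k, rfl⟩ := Nat.exists_eq_add_of_lt hc
  have e1 : 2 * (c + k + 1) - 1 = (2 * k + 1) + 2 * c := by omega
  have e2 : 2 * (c + k + 1) - 2 * (c + 1) + 1 = 2 * k + 1 := by omega
  have e3 : c + k + 1 - 1 - c = k := by omega
  have hD : poch (X - 1 - ((2 * k + 1 + 2 * c : ℕ) : ℝ[X]) + C (2 * a + N + 2)) (2 * k + 1 + 2 * c)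
      = poch (X - 2 * ((c + 1 : ℕ) : ℝ[X]) + 1 - ((2 * k + 1 : ℕ) : ℝ[X]) + C (2 * a + N + 2))
        (2 * k + 1) * denWeight (a + 3 / 2) N c := by
    rw [poch, Finset.prod_range_add, denWeight_eq, poch]
    congr 1 <;>
    · refine Finset.prod_congr rfl fun r _ => ?_
      simp only [map_add, map_sub, map_mul, map_natCast, map_ofNat, map_one]
      push_cast; ring
  have hN : poch (X - 2 * ((c + 1 : ℕ) : ℝ[X]) + 1 - ((2 * k + 1 : ℕ) : ℝ[X]) - C N) (2 * k + 1)
      = numN N (X - ((2 * (c + k + 1) : ℕ) : ℝ[X]) + 1) 1 * numWeight N (c + k + 1) k := by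
    rw [poch, Finset.prod_range_succ', numN, poch, Finset.prod_range_one, numWeight_eq, mul_comm]
    congr 1
    · push_cast; ring
    · refine Finset.prod_congr rfl fun r _ => ?_
      simp only [map_sub, map_mul, map_natCast, map_ofNat, map_one]
      push_cast; ring
  rw [e1, e2, e3, denD, hD, numN, hN, denD, pow_add, (even_two_mul c).neg_one_pow]
  ring

theorem node_eq_theta (c : ℕ) :
    node (a + 3 / 2) c = theta a (X - 2 * ((c + 1 : ℕ) : ℝ[X]) + 1) := by
  have : (2 * (a + 3 / 2) - 2 : ℝ) = 2 * a + 1 := by ring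
  rw [node, theta, this]
  simp only [map_add, map_mul, map_natCast, map_ofNat, map_one]
  push_cast; ring

theorem polyp_eq (m₁ m₃ : ℕ) : polyp a N m₁ m₃ = pPoly (a + 3 / 2) N (m₁ + m₃) m₁ := by
  rw [polyp, pPoly]
  cases m₁ with
  | zero => simp
  | succ k =>
    rw [Finset.prod_range_succ', Nat.add_sub_cancel]
    have h0 : denWeight (a + 3 / 2) N 0 * numWeight N (k + 1 + m₃) 0 = 1 := by
      simp [denWeight, numWeight]
    rw [h0, mul_one]
    refine Finset.prod_bij' (fun j _ => j - 1) (fun j _ => j + 1) ?_ ?_ ?_ ?_ ?_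
    any_goals
      intro j hj
      simp only [Finset.mem_Icc, Finset.mem_range] at hj ⊢
      omega
    intro j hj
    rw [Nat.sub_add_cancel (Finset.mem_Icc.1 hj).1, denD, numN, poch, poch, denWeight_eq,
      numWeight_eq, (even_two_mul j).neg_one_pow, one_mul]
    congr 1 <;>
    · refine Finset.prod_congr rfl fun r _ => ?_
      simp only [map_add, map_sub, map_mul, map_natCast, map_ofNat, map_one]
      push_cast; ring

theorem sigma_eq (n s : ℕ) : sigma a (X - ((n : ℕ) : ℝ[X]) + ((s : ℕ) : ℝ[X])) =
    C (-2) * (X - C ((n : ℝ) + 2 - s - (a + 3 / 2))) := by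
  have h2 : (2 : ℝ[X]) = C 2 := (map_ofNat C 2).symm
  rw [sigma, ← C_eq_natCast, ← C_eq_natCast, h2]
  have : C ((n : ℝ) + 2 - s - (a + 3 / 2)) = C (n : ℝ) - C (s : ℝ) - C (a - 1 / 2) := by
    rw [← C_sub, ← C_sub]; congr 1; ring
  have h3 : C (2 * a - 1) = C 2 * C (a - 1 / 2) := by rw [← C_mul]; congr 1; ring
  rw [this, h3, C_neg]
  ring

/-- The factors of `q` with a given `i` are matched by `s = 2n - 2i + 2 - j`. -/
theorem polyq_eq (m₁ m₃ : ℕ) : ∃ κ : ℝ, κ ≠ 0 ∧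
    polyq a m₁ m₃ = C κ * qPoly (a + 3 / 2) (m₁ + m₃) := by
  set n := m₁ + m₃ with hn
  refine ⟨∏ i ∈ Finset.Icc 1 (n / 2), ∏ s ∈ Finset.Icc (2 * i + 1) (2 * n - 2 * i + 1), (-2),
    Finset.prod_ne_zero_iff.2 fun i _ => Finset.prod_ne_zero_iff.2 fun s _ => by norm_num, ?_⟩
  rw [polyq, qPoly, ← hn]
  simp only [map_prod]
  rw [← Finset.prod_mul_distrib]
  refine Finset.prod_congr rfl fun i hi => ?_
  rw [Finset.mem_Icc] at hi
  rw [← Finset.prod_mul_distrib]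
  refine Finset.prod_bij' (fun j _ => 2 * n - 2 * i + 2 - j) (fun s _ => 2 * n - 2 * i + 2 - s)
    ?_ ?_ ?_ ?_ ?_
  any_goals
    intro j hj
    simp only [Finset.mem_Icc] at hj ⊢
    omega
  intro j hj
  rw [Finset.mem_Icc] at hj
  have := sigma_eq a (2 * n) (2 * i + j)
  rw [show X - ((2 * n : ℕ) : ℝ[X]) + 2 * (i : ℝ[X]) + (j : ℝ[X])
    = X - ((2 * n : ℕ) : ℝ[X]) + ((2 * i + j : ℕ) : ℝ[X]) by push_cast; ring, this]
  have hs : ((2 * n - 2 * i + 2 - j : ℕ) : ℝ) + (2 * i + j : ℕ) = (2 * n : ℕ) + 2 := by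
    exact_mod_cast (by omega : 2 * n - 2 * i + 2 - j + (2 * i + j) = 2 * n + 2)
  rw [← hs, add_sub_cancel_right]

theorem monic_poch {y : ℝ[X]} {c : ℝ} (hy : y = X + C c) (j : ℕ) : (poch y j).Monic := by
  subst hy
  refine monic_prod_of_monic _ _ fun i _ => ?_
  rw [← C_eq_natCast, add_assoc, ← C_add]
  exact monic_X_add_C _

theorem denD_ne_zero {y : ℝ[X]} {c : ℝ} (hy : y = X + C c) (j : ℕ) : denD a N y j ≠ 0 := by
  refine mul_ne_zero (pow_ne_zero _ (by simp))
    (monic_poch (c := c - j + (2 * a + N + 2)) ?_ j).ne_zero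
  rw [hy, C_add (a := c - j), C_sub, C_eq_natCast]
  ring

theorem numN_ne_zero {y : ℝ[X]} {c : ℝ} (hy : y = X + C c) (j : ℕ) : numN N y j ≠ 0 := by
  refine (monic_poch (c := c - j - N) ?_ j).ne_zero
  rw [hy, C_sub, C_sub, C_eq_natCast]
  ring

end Clear

/-! ### The quasi-Casoratian determinant -/

/-- The row polynomials of the determinant: those of `Y` over `U`, then those of `Z` over `V`. -/
noncomputable def rowPoly (U V : Finset ℕ) (Y Z : ℕ → ℝ[X]) : Fin (U.card + V.card) → ℝ[X] :=
  Fin.addCases (fun r => Y (U.orderEmbOfFin rfl r)) (fun r => Z (V.orderEmbOfFin rfl r))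

/-- The first `k` of `k + l` rows. -/
def firstRows (k l : ℕ) : Finset (Fin (k + l)) := Finset.univ.map (Fin.castAddEmb l)

theorem card_firstRows (k l : ℕ) : (firstRows k l).card = k := by simp [firstRows]

theorem castAdd_mem_firstRows {k l : ℕ} (r : Fin k) : Fin.castAdd l r ∈ firstRows k l :=
  Finset.mem_map.2 ⟨r, Finset.mem_univ _, rfl⟩

theorem natAdd_notMem_firstRows {k l : ℕ} (r : Fin l) : Fin.natAdd k r ∉ firstRows k l := by
  simp only [firstRows, Finset.mem_map, not_exists, not_and]
  intro s _ hs
  have := congrArg Fin.val hs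
  simp only [Fin.castAddEmb_apply, Fin.val_castAdd, Fin.val_natAdd] at this
  omega

theorem denD_pow_mul_quasiCasoratian₁ (a N : ℝ) (U V : Finset ℕ) (Y Z : ℕ → ℝ[X]) :
    algebraMap ℝ[X] (RatFunc ℝ) (denD a N (X - 1) (2 * (U.card + V.card) - 1) ^ U.card) *
        quasiCasoratian₁ U V Y Z (xi1 a N) xi3 (theta a) =
      algebraMap ℝ[X] (RatFunc ℝ)
        (numN N (X - ((2 * (U.card + V.card) : ℕ) : ℝ[X]) + 1) 1 ^ U.card *
        (polyMatrix (a + 3 / 2) N (U.card + V.card) (firstRows U.card V.card)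
          (rowPoly U V Y Z)).det) := by
  have hprod : ∀ f : ℝ[X], ∏ i, (if i ∈ firstRows U.card V.card then f else 1) = f ^ U.card := by
    intro f
    rw [Finset.prod_ite_mem, Finset.univ_inter, Finset.prod_const, card_firstRows]
  rw [← hprod, ← hprod, ← Matrix.det_mul_column, RingHom.map_det, map_prod, quasiCasoratian₁,
    ← Matrix.det_mul_column]
  congr 1
  ext1 i k
  induction i using Fin.addCases with
  | left r =>
    have hy : X - 2 * (((k : ℕ) + 1 : ℕ) : ℝ[X]) + 1 = X + C (1 - 2 * (((k : ℕ) : ℝ) + 1)) := by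
      simp only [map_add, map_sub, map_mul, map_natCast, map_ofNat, map_one]
      push_cast; ring
    have hne : algebraMap ℝ[X] (RatFunc ℝ) (denD a N (X - 2 * (((k : ℕ) + 1 : ℕ) : ℝ[X]) + 1)
        (2 * (U.card + V.card) - 2 * (k + 1) + 1)) ≠ 0 := by
      rw [Ne, map_eq_zero_iff _ (IsFractionRing.injective ℝ[X] (RatFunc ℝ))]
      exact denD_ne_zero a N hy _
    have hw := congrArg (algebraMap ℝ[X] (RatFunc ℝ))
      (denD_mul_numN a N (U.card + V.card) k k.2)
    rw [map_mul (algebraMap ℝ[X] (RatFunc ℝ)),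
      map_mul (algebraMap ℝ[X] (RatFunc ℝ)) _ (denD a N _ _)] at hw
    simp only [polyMatrix, rowPoly, castAdd_mem_firstRows, if_true, Matrix.of_apply,
      Fin.addCases_left, node_eq_theta, RingHom.mapMatrix_apply, Matrix.map_apply, xi1]
    rw [← mul_assoc, mul_div_assoc', hw, mul_div_cancel_right₀ _ hne, ← map_mul, mul_assoc]
  | right r =>
    simp [polyMatrix, rowPoly, natAdd_notMem_firstRows, xi3, node_eq_theta]

theorem sum_orderEmbOfFin (U : Finset ℕ) : ∑ r, U.orderEmbOfFin rfl r = ∑ u ∈ U, u := by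
  conv_rhs => rw [← U.map_orderEmbOfFin_univ rfl, Finset.sum_map]
  rfl

/-- The theorem in terms of the index sets `U = I(F)` and `V = I(G)` themselves. -/
theorem exists_ratH_mul_quasiCasoratian₁ (a N : ℝ) (U V : Finset ℕ)
    (hY : ∀ u ∈ U, DualHahnDefined (-a) (2 * a + N) u)
    (hZ : ∀ v ∈ V, DualHahnDefined (-a) (-2 - N) v) :
    ∃ P : ℝ[X],
      ratH a N U.card V.card *
          quasiCasoratian₁ U V (polyY a N) (polyZ a N) (xi1 a N) xi3 (theta a) =
        algebraMap ℝ[X] (RatFunc ℝ)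
          (sigma a (X - (U.card : ℝ[X]) - (V.card : ℝ[X]) + 1) * P) ∧
      ((∀ u ∈ U, ∀ v ∈ V, (v : ℝ) - (u : ℝ) + a + N + 1 ≠ 0) →
        P ≠ 0 ∧
        (P.natDegree : ℤ) =
          2 * ((∑ u ∈ U, (u : ℤ)) + (∑ v ∈ V, (v : ℤ))
            - (U.card.choose 2 : ℤ) - (V.card.choose 2 : ℤ))) := by
  set g := rowPoly U V (polyY a N) (polyZ a N) with hg
  set M := polyMatrix (a + 3 / 2) N (U.card + V.card) (firstRows U.card V.card) g with hM
  obtain ⟨Q, hQ⟩ := pPoly_mul_qPoly_dvd_det (a + 3 / 2) N (U.card + V.card)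
    (firstRows U.card V.card) g
  obtain ⟨κ, hκ, hq⟩ := polyq_eq a U.card V.card
  rw [card_firstRows, ← hM] at hQ
  have hΩ := denD_pow_mul_quasiCasoratian₁ a N U V (polyY a N) (polyZ a N)
  rw [← hg, ← hM] at hΩ
  have hp0 := monic_pPoly (a + 3 / 2) N (U.card + V.card) U.card
  have hq0 := monic_qPoly (a + 3 / 2) (U.card + V.card)
  refine ⟨C κ⁻¹ * Q, ?_, fun hres => ?_⟩
  · have hN0 : numN N (X - ((2 * (U.card + V.card) : ℕ) : ℝ[X]) + 1) 1 ≠ 0 :=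
      numN_ne_zero N (c := 1 - (2 * (U.card + V.card) : ℕ)) (by
        rw [C_sub, C_eq_natCast, C_1]; ring) 1
    have hCκ : (C κ : ℝ[X]) * C κ⁻¹ = 1 := by rw [← C_mul, mul_inv_cancel₀ hκ, C_1]
    rw [ratH, polyp_eq, hq, div_mul_eq_mul_div, div_eq_iff, map_mul, mul_assoc, hΩ,
      ← map_mul, ← map_mul, hQ]
    · congr 1
      linear_combination (-(sigma a (X - (U.card : ℝ[X]) - (V.card : ℝ[X]) + 1) *
        numN N (X - ((2 * (U.card + V.card) : ℕ) : ℝ[X]) + 1) 1 ^ U.card *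
        pPoly (a + 3 / 2) N (U.card + V.card) U.card * qPoly (a + 3 / 2) (U.card + V.card) *
        Q)) * hCκ
    · rw [Ne, map_eq_zero_iff _ (IsFractionRing.injective ℝ[X] (RatFunc ℝ))]
      exact mul_ne_zero (mul_ne_zero hp0.ne_zero (mul_ne_zero (C_ne_zero.2 hκ) hq0.ne_zero))
        (pow_ne_zero _ hN0)
  · have hgU : ∀ r, g (Fin.castAdd V.card r) = polyY a N (U.orderEmbOfFin rfl r) := fun r => by
      rw [hg, rowPoly, Fin.addCases_left]
    have hgV : ∀ r, g (Fin.natAdd U.card r) = polyZ a N (V.orderEmbOfFin rfl r) := fun r => by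
      rw [hg, rowPoly, Fin.addCases_right]
    have hdU : ∀ r, (g (Fin.castAdd V.card r)).natDegree = U.orderEmbOfFin rfl r := fun r => by
      rw [hgU, natDegree_polyY (hY _ (U.orderEmbOfFin_mem rfl r))]
    have hdV : ∀ r, (g (Fin.natAdd U.card r)).natDegree = V.orderEmbOfFin rfl r := fun r => by
      rw [hgV, natDegree_polyZ (hZ _ (V.orderEmbOfFin_mem rfl r))]
    have hg0 : ∀ i, g i ≠ 0 := by
      intro i
      induction i using Fin.addCases with
      | left r => rw [hgU]; exact polyY_ne_zero (hY _ (U.orderEmbOfFin_mem rfl r))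
      | right r => rw [hgV]; exact polyZ_ne_zero (hZ _ (V.orderEmbOfFin_mem rfl r))
    obtain ⟨h0, hdeg⟩ := natDegree_det_polyMatrix (a + 3 / 2) N (U.card + V.card)
        (firstRows U.card V.card) g hg0 (by
      intro i j hij
      induction i using Fin.addCases with
      | left r =>
        induction j using Fin.addCases with
        | left s =>
          simp only [castAdd_mem_firstRows, if_true, hdU] at hij
          have : U.orderEmbOfFin rfl r = U.orderEmbOfFin rfl s := by
            exact_mod_cast (by linarith : ((U.orderEmbOfFin rfl r : ℕ) : ℝ) = U.orderEmbOfFin rfl s)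
          rw [(U.orderEmbOfFin rfl).injective this]
        | right s =>
          simp only [castAdd_mem_firstRows, natAdd_notMem_firstRows, if_true, if_false, hdU,
            hdV] at hij
          exact absurd (by linarith) (hres _ (U.orderEmbOfFin_mem rfl r) _
            (V.orderEmbOfFin_mem rfl s))
      | right r =>
        induction j using Fin.addCases with
        | left s =>
          simp only [castAdd_mem_firstRows, natAdd_notMem_firstRows, if_true, if_false, hdU,
            hdV] at hij
          exact absurd (by linarith) (hres _ (U.orderEmbOfFin_mem rfl s) _
            (V.orderEmbOfFin_mem rfl r))
        | right s =>
          simp only [natAdd_notMem_firstRows, if_false, hdV] at hij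
          have : V.orderEmbOfFin rfl r = V.orderEmbOfFin rfl s := by
            exact_mod_cast (by linarith : ((V.orderEmbOfFin rfl r : ℕ) : ℝ) = V.orderEmbOfFin rfl s)
          rw [(V.orderEmbOfFin rfl).injective this])
    rw [← hM] at h0 hdeg
    have hQ0 : Q ≠ 0 := fun h => h0 (by rw [hQ, h, mul_zero])
    refine ⟨mul_ne_zero (C_ne_zero.2 (inv_ne_zero hκ)) hQ0, ?_⟩
    rw [natDegree_C_mul (inv_ne_zero hκ)]
    rw [hQ, natDegree_mul (mul_ne_zero hp0.ne_zero hq0.ne_zero) hQ0, hp0.natDegree_mul hq0,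
      natDegree_pPoly, natDegree_qPoly, Fin.sum_univ_add] at hdeg
    simp only [hdU, hdV, castAdd_mem_firstRows, natAdd_notMem_firstRows, if_true, if_false,
      add_zero, Finset.sum_add_distrib, ← Finset.mul_sum, sum_orderEmbOfFin, Finset.sum_const,
      Finset.card_univ, Fintype.card_fin, smul_eq_mul] at hdeg
    have hc : ∀ k : ℕ, (k.choose 2 : ℤ) * 2 = k * (k - 1) := fun k => by
      have := Nat.choose_two_right k
      have h4 : k.choose 2 * 2 = k * (k - 1) := by
        rw [this, Nat.div_mul_cancel (Nat.even_mul_pred_self k).two_dvd]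
      cases k with
      | zero => simp
      | succ k => rw [Nat.add_sub_cancel] at h4; push_cast; zify at h4; linarith
    have hw : ((2 * (U.card * (U.card + V.card - 1)) : ℕ) : ℤ) =
        2 * (U.card * (U.card + V.card - 1)) := by
      rcases Nat.eq_zero_or_pos U.card with h | h
      · simp [h]
      · rw [Nat.cast_mul, Nat.cast_mul, Nat.cast_sub (by omega)]; push_cast; ring
    have h1 := hc U.card
    have h2 := hc V.card
    have h3 := hc (U.card + V.card)
    have h5 := congrArg (Nat.cast : ℕ → ℤ) hdeg
    rw [Nat.cast_add, Nat.cast_add, Nat.cast_add, Nat.cast_add, Nat.cast_add, hw] at h5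
    push_cast at h3 h5
    linarith

end KrallHahn

theorem mainTheorem5 (a N : ℝ) (F G : Finset ℕ)
    (hF : ∀ f ∈ F, 0 < f) (hG : ∀ g ∈ G, 0 < g)
    (hY : ∀ u ∈ KrallHahn.invol F, KrallHahn.DualHahnDefined (-a) (2 * a + N) u)
    (hZ : ∀ v ∈ KrallHahn.invol G, KrallHahn.DualHahnDefined (-a) (-2 - N) v) :
    ∃ P : Polynomial ℝ,
      KrallHahn.ratH a N (KrallHahn.invol F).card (KrallHahn.invol G).card *
          KrallHahn.Omega₁ a N F G =
        algebraMap (Polynomial ℝ) (RatFunc ℝ)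
          (KrallHahn.sigma a
              (Polynomial.X - ((KrallHahn.invol F).card : Polynomial ℝ)
                - ((KrallHahn.invol G).card : Polynomial ℝ) + 1) * P) ∧
      ((∀ u ∈ KrallHahn.invol F, ∀ v ∈ KrallHahn.invol G, (v : ℝ) - (u : ℝ) + a + N + 1 ≠ 0) →
        P ≠ 0 ∧
        (P.natDegree : ℤ) =
          2 * ((∑ u ∈ KrallHahn.invol F, (u : ℤ)) + (∑ v ∈ KrallHahn.invol G, (v : ℤ))
            - ((KrallHahn.invol F).card.choose 2 : ℤ)
            - ((KrallHahn.invol G).card.choose 2 : ℤ))) := by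
  exact KrallHahn.exists_ratH_mul_quasiCasoratian₁ a N _ _ hY hZ
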